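/- For a finite simple graph $G$, a \emph{crossing-free circular-arc drawing} of $G$ in $\mathbb{R}^3$ represents the vertices by distinct points and each edge by a circular arc connecting the points of its two end vertices, such that no arc passes through a point of a vertex that is not an end vertex of its edge, and any two distinct arcs meet at most in a common end vertex. Let $\sigma^1_3(G)$ be the minimum number of circles in $\mathbb{R}^3$ whose union contains a crossing-free circular-arc drawing of $G$. Then, for all positive integers $n$, $p$ and $q$: (a) $\lfloor n^2/8\rfloor \le \sigma^1_3(K_n) \le (n^2+5n+6)/6$, and (b) $\lceil pq/4\rceil \le \sigma^1_3(K_{p,q}) \le \lceil p/2\rceil\,\lceil q/2\rceil$. Here $K_n$ is the complete graph on $n$ vertices and $K_{p,q}$ is the complete bipartite graph with parts of sizes $p$ and $q$. -/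

import Mathlib

namespace SphericalCover

/-- `S` is an `l`-dimensional round sphere in `ℝᵈ`: the set of all points at some fixed distance
`r > 0` from a centre `c`, inside an `(l + 1)`-dimensional affine subspace through `c`.
For `l = 1` these are the circles in `ℝᵈ`. -/
def IsRoundSphere (l d : ℕ) (S : Set (EuclideanSpace ℝ (Fin d))) : Prop :=
  ∃ (A : AffineSubspace ℝ (EuclideanSpace ℝ (Fin d))) (c : EuclideanSpace ℝ (Fin d)) (r : ℝ),
    c ∈ A ∧ Module.finrank ℝ A.direction = l + 1 ∧ 0 < r ∧ S = {x | x ∈ A ∧ dist x c = r}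

/-- The point at angle `t` on the circle with centre `c` and (perpendicular, equally long)
radius vectors `u` and `v`. -/
noncomputable def circlePoint {d : ℕ} (c u v : EuclideanSpace ℝ (Fin d)) (t : ℝ) :
    EuclideanSpace ℝ (Fin d) :=
  c + Real.cos t • u + Real.sin t • v

/-- `A` is a (closed, proper, nondegenerate) circular arc in `ℝᵈ` with endpoints `a` and `b`:
the part of a circle that is swept by an angle `θ` with `0 < θ < 2π`, starting at `a` and
ending at `b`. -/
def IsCircularArc {d : ℕ} (A : Set (EuclideanSpace ℝ (Fin d)))
    (a b : EuclideanSpace ℝ (Fin d)) : Prop :=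
  ∃ (c u v : EuclideanSpace ℝ (Fin d)) (θ : ℝ),
    u ≠ 0 ∧ ‖u‖ = ‖v‖ ∧ inner ℝ u v = 0 ∧ 0 < θ ∧ θ < 2 * Real.pi ∧
    a = circlePoint c u v 0 ∧ b = circlePoint c u v θ ∧
    A = circlePoint c u v '' Set.Icc 0 θ

/-- A crossing-free circular-arc drawing of the graph `G` in `ℝᵈ`: the vertices are distinct
points, each edge is a circular arc between its two end vertices that passes through no other
vertex, and two distinct edges meet at most in a common end vertex. -/
structure ArcDrawing {V : Type*} (G : SimpleGraph V) (d : ℕ) where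
  /-- the point that represents a vertex -/
  pos : V → EuclideanSpace ℝ (Fin d)
  /-- the arc that represents an edge -/
  arc : G.edgeSet → Set (EuclideanSpace ℝ (Fin d))
  pos_injective : Function.Injective pos
  isCircularArc : ∀ (v w : V) (h : G.Adj v w),
    IsCircularArc (arc ⟨s(v, w), (G.mem_edgeSet).2 h⟩) (pos v) (pos w)
  vertex_on_arc : ∀ (e : G.edgeSet) (v : V), pos v ∈ arc e → v ∈ (e : Sym2 V)
  crossing_free : ∀ e f : G.edgeSet, e ≠ f → ∀ x ∈ arc e ∩ arc f,
    ∃ v : V, v ∈ (e : Sym2 V) ∧ v ∈ (f : Sym2 V) ∧ x = pos v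

/-- The set of points occupied by a drawing: all its vertices and all its arcs. -/
def ArcDrawing.carrier {V : Type*} {G : SimpleGraph V} {d : ℕ} (D : ArcDrawing G d) :
    Set (EuclideanSpace ℝ (Fin d)) :=
  Set.range D.pos ∪ ⋃ e, D.arc e

/-- The spherical cover number `σˡ_d(G)`: the minimum number of `l`-dimensional spheres in `ℝᵈ`
whose union contains a crossing-free circular-arc drawing of `G`
(and `⊤` if no finite family of spheres does). -/
noncomputable def sphericalCoverNumber {V : Type*} (l d : ℕ) (G : SimpleGraph V) : ℕ∞ :=
  sInf {k : ℕ∞ | ∃ (D : ArcDrawing G d) (𝒮 : Set (Set (EuclideanSpace ℝ (Fin d)))),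
    (∀ S ∈ 𝒮, IsRoundSphere l d S) ∧ D.carrier ⊆ ⋃₀ 𝒮 ∧ 𝒮.encard = k}

end SphericalCover

namespace SphericalCover

/-! Lower bounds. A plane that contains none of the covering circles meets each of them in at most
two points. Move such a plane to a level strictly between a vertex set `T` and its complement: every
edge leaving `T` crosses it, and crossing-freeness makes these crossing points distinct. Hence at
most twice as many edges leave `T` as there are circles (`ArcDrawing.card_crossing_le`). For the
complete graph a balanced cut suffices; for the complete bipartite graph the cut goes through the
median of one part, and for odd `p` the cuts just before and just after the median are added up.

Upper bounds. Stereographic projection turns great circles of the unit sphere in `ℝ⁴` that avoid the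
pole into circles of `ℝ³`, so a point `x` may be handled through the ray of `lift x`, and a circle
through a linear plane. Group the vertices into antipodal pairs `±momentVec (t k)`. The plane of two
pairs gives one circle that carries all four edges between them, each edge being a cone
(`isCircularArc_cone`). The two points of one pair are joined by a half circle in a plane that uses
an extra point of the moment curve (`isCircularArc_halfCircle`). Any four points of the moment curve
are linearly independent, so points in two such planes have unique coordinates (`comb_injOn`), and
arcs meet only at common vertices (`exists_vertexPoint_of_mem_edgeArc`). With `m = ⌈n/2⌉` pairs this
costs `m(m+1)/2` circles for the complete graph. In the bipartite case pairs are formed within the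
parts, and one circle per pair of pairs is enough. -/

/-! ### Lower bounds: cutting a drawing by a generic hyperplane -/

lemma exists_card_filter_lt_eq {V : Type*} [Fintype V] {f : V → ℝ} (hf : Function.Injective f)
    {a : ℕ} (ha : a < Fintype.card V) :
    ∃ m : V, (Finset.univ.filter fun v => f v < f m).card = a := by
  classical
  have hlt : ∀ m : V, (Finset.univ.filter fun v => f v < f m).card < Fintype.card V := fun m =>
    Finset.card_lt_univ_of_notMem (x := m) (by simp)
  have hmono : ∀ m m' : V, f m < f m' → (Finset.univ.filter fun v => f v < f m).card <
      (Finset.univ.filter fun v => f v < f m').card := by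
    intro m m' h
    apply Finset.card_lt_card
    refine Finset.ssubset_iff_of_subset (fun v hv => ?_) |>.2 ⟨m, by simpa using h, by simp⟩
    simp only [Finset.mem_filter, Finset.mem_univ, true_and] at hv ⊢
    exact hv.trans h
  let r : V → Fin (Fintype.card V) := fun m => ⟨_, hlt m⟩
  have hr : Function.Injective r := by
    intro m m' h
    have h' : (Finset.univ.filter fun v => f v < f m).card =
      (Finset.univ.filter fun v => f v < f m').card := congrArg Fin.val h
    by_contra hne
    rcases lt_or_gt_of_ne (hf.ne hne) with h1 | h1
    · exact (hmono _ _ h1).ne h'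
    · exact (hmono _ _ h1).ne' h'
  have hs : Function.Surjective r :=
    ((Fintype.bijective_iff_injective_and_card r).2 ⟨hr, by simp⟩).2
  obtain ⟨m, hm⟩ := hs ⟨a, ha⟩
  exact ⟨m, congrArg Fin.val hm⟩

/-- A functional only has to avoid vanishing on the finitely many nonzero differences of points. -/
lemma exists_functional_injective {E V : Type*} [AddCommGroup E] [Module ℝ E]
    [FiniteDimensional ℝ E] [Finite V]
    {x : V → E} (hx : Function.Injective x) :
    ∃ l : E →ₗ[ℝ] ℝ, Function.Injective fun v => l (x v) := by
  classical
  obtain ⟨l, hl⟩ := Module.exists_dual_forall_apply_ne_zero (K := ℝ) (M := E)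
    (ι := {q : V × V // q.1 ≠ q.2}) (fun q => x q.1.1 - x q.1.2)
    (fun q => sub_ne_zero.2 (hx.ne q.2))
  refine ⟨l, fun v w h => ?_⟩
  by_contra hne
  apply hl ⟨(v, w), hne⟩
  simpa [sub_eq_zero] using h

variable {d : ℕ}

lemma IsRoundSphere.nonempty {l d : ℕ} {S : Set (EuclideanSpace ℝ (Fin d))}
    (hS : IsRoundSphere l d S) : S.Nonempty := by
  obtain ⟨A, c, r, hc, hA, hr, rfl⟩ := hS
  have : Nontrivial A.direction := Module.nontrivial_of_finrank_pos (R := ℝ) (by omega)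
  obtain ⟨v, hv⟩ := exists_ne (0 : A.direction)
  have hv' : ‖(v : EuclideanSpace ℝ (Fin d))‖ ≠ 0 := by simpa using hv
  refine ⟨(r / ‖(v : EuclideanSpace ℝ (Fin d))‖) • (v : EuclideanSpace ℝ (Fin d)) +ᵥ c, ?_, ?_⟩
  · exact AffineSubspace.vadd_mem_of_mem_direction (A.direction.smul_mem _ v.2) hc
  · simp [norm_smul, abs_of_pos hr, hv']

/-- Three distinct points of a circle are affinely independent, hence span its plane; a functional
constant on them is constant on the whole circle. -/
lemma IsRoundSphere.encard_inter_le {d : ℕ} {S : Set (EuclideanSpace ℝ (Fin d))}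
    (hS : IsRoundSphere 1 d S) (l : EuclideanSpace ℝ (Fin d) →ₗ[ℝ] ℝ) (t : ℝ)
    (ht : ¬ ∀ x ∈ S, l x = t) : (S ∩ {x | l x = t}).encard ≤ 2 := by
  by_contra! h
  obtain ⟨T, hTS, hT⟩ := Set.exists_subset_encard_eq (k := 3) (Order.add_one_le_of_lt h)
  obtain ⟨x, y, z, hxy, hxz, hyz, rfl⟩ := Set.encard_eq_three.1 hT
  obtain ⟨hxm, hym, hzm⟩ : x ∈ S ∩ {x | l x = t} ∧ y ∈ S ∩ {x | l x = t} ∧ z ∈ S ∩ {x | l x = t} :=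
    ⟨hTS (by simp), hTS (by simp), hTS (by simp)⟩
  obtain ⟨A, c, r, hc, hA, hr, rfl⟩ := hS
  obtain ⟨⟨hxA, hxd⟩, hxl⟩ := hxm
  obtain ⟨⟨hyA, hyd⟩, hyl⟩ := hym
  obtain ⟨⟨hzA, hzd⟩, hzl⟩ := hzm
  have hind : AffineIndependent ℝ ![x, y, z] := by
    have hcs : EuclideanGeometry.Cospherical ({x, y, z} : Set (EuclideanSpace ℝ (Fin d))) :=
      ⟨c, r, by simp [hxd, hyd, hzd]⟩
    exact hcs.affineIndependent_of_ne hxy hxz hyz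
  have hspan : vectorSpan ℝ (Set.range ![x, y, z]) = A.direction := by
    apply Submodule.eq_of_le_of_finrank_eq
    · rw [← direction_affineSpan]
      apply AffineSubspace.direction_le
      apply affineSpan_le.2
      rintro _ ⟨i, rfl⟩
      fin_cases i <;> assumption
    · rw [hind.finrank_vectorSpan (n := 2) (by simp), hA]
  have hker : vectorSpan ℝ (Set.range ![x, y, z]) ≤ LinearMap.ker l := by
    apply Submodule.span_le.2
    rintro _ ⟨_, ⟨i, rfl⟩, _, ⟨j, rfl⟩, rfl⟩
    simp only [Set.mem_ofPred_eq] at hxl hyl hzl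
    fin_cases i <;> fin_cases j <;> simp [hxl, hyl, hzl]
  apply ht
  rintro w ⟨hwA, -⟩
  have : w - x ∈ LinearMap.ker l := hker (hspan ▸ AffineSubspace.vsub_mem_direction hwA hxA)
  simp only [LinearMap.mem_ker, map_sub, sub_eq_zero] at this
  exact this.trans hxl

lemma IsCircularArc.exists_apply_eq {A : Set (EuclideanSpace ℝ (Fin d))}
    {a b : EuclideanSpace ℝ (Fin d)} (h : IsCircularArc A a b)
    (l : EuclideanSpace ℝ (Fin d) →ₗ[ℝ] ℝ) {t : ℝ} (ha : l a < t) (hb : t < l b) :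
    ∃ x ∈ A, l x = t := by
  obtain ⟨c, u, v, θ, -, -, -, hθ, -, rfl, rfl, rfl⟩ := h
  have hl : Continuous l := l.continuous_of_finiteDimensional
  have hcont : Continuous fun s => l (circlePoint c u v s) := by
    apply hl.comp
    unfold circlePoint
    fun_prop
  obtain ⟨s, hs, hst⟩ := intermediate_value_Icc hθ.le hcont.continuousOn ⟨ha.le, hb.le⟩
  exact ⟨_, ⟨s, hs, rfl⟩, hst⟩

lemma ArcDrawing.card_crossing_le {V : Type*} [Fintype V] [DecidableEq V] {G : SimpleGraph V}
    [DecidableRel G.Adj]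
    {d : ℕ} (D : ArcDrawing G d) {𝒮 : Set (Set (EuclideanSpace ℝ (Fin d)))}
    (hfin : 𝒮.Finite) (h𝒮 : ∀ S ∈ 𝒮, IsRoundSphere 1 d S) (hcov : D.carrier ⊆ ⋃₀ 𝒮)
    (l : EuclideanSpace ℝ (Fin d) →ₗ[ℝ] ℝ) (T : Finset V)
    (hT : ∀ v ∈ T, ∀ w ∉ T, l (D.pos v) < l (D.pos w)) :
    ((T ×ˢ Tᶜ).filter fun q => G.Adj q.1 q.2).card ≤ 2 * 𝒮.ncard := by
  classical
  rcases T.eq_empty_or_nonempty with rfl | hne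
  · simp
  rcases Tᶜ.eq_empty_or_nonempty with h0 | hne'
  · simp [h0]
  obtain ⟨v₀, hv₀, hmax⟩ := T.exists_max_image (fun v => l (D.pos v)) hne
  obtain ⟨w₀, hw₀, hmin⟩ := Tᶜ.exists_min_image (fun v => l (D.pos v)) hne'
  have hlt := hT v₀ hv₀ w₀ (by simpa using hw₀)
  have hbad : {t : ℝ | ∃ S ∈ 𝒮, ∀ x ∈ S, l x = t}.Finite := by
    have : {t : ℝ | ∃ S ∈ 𝒮, ∀ x ∈ S, l x = t} = ⋃ S ∈ 𝒮, {t | ∀ x ∈ S, l x = t} := by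
      ext; simp
    rw [this]
    refine hfin.biUnion fun S hS => Set.Subsingleton.finite fun t ht t' ht' => ?_
    obtain ⟨x, hx⟩ := (h𝒮 S hS).nonempty
    exact (ht x hx).symm.trans (ht' x hx)
  -- Each circle is contained in at most one level set, so only finitely many levels in the gap
  -- between `T` and its complement are excluded.
  obtain ⟨t, ⟨ht1, ht2⟩, htb⟩ := ((Set.Ioo_infinite hlt).sdiff hbad).nonempty
  simp only [Set.mem_ofPred_eq, not_exists, not_and] at htb
  have hpos : ∀ v, l (D.pos v) ≠ t := fun v => by
    by_cases hv : v ∈ T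
    · exact ((hmax v hv).trans_lt ht1).ne
    · exact (ht2.trans_le (hmin v (by simpa using hv))).ne'
  have hex : ∀ q : V × V, q ∈ (T ×ˢ Tᶜ).filter (fun q => G.Adj q.1 q.2) →
      ∃ (x : EuclideanSpace ℝ (Fin d)) (h : G.Adj q.1 q.2),
        x ∈ D.arc ⟨s(q.1, q.2), G.mem_edgeSet.2 h⟩ ∧ l x = t := by
    rintro ⟨v, w⟩ hq
    simp only [Finset.mem_filter, Finset.mem_product] at hq
    obtain ⟨x, hx, hxt⟩ := (D.isCircularArc v w hq.2).exists_apply_eq l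
      ((hmax v hq.1.1).trans_lt ht1) (ht2.trans_le (hmin w hq.1.2))
    exact ⟨x, hq.2, hx, hxt⟩
  choose! X hadj hX hXt using hex
  -- `Z` collects the points of the circles at level `t`; the default `∅` never occurs, since each
  -- section has at most two points.
  set Z := hfin.toFinset.biUnion fun S =>
    if h : (S ∩ {x | l x = t}).Finite then h.toFinset else ∅ with hZ
  have hfin2 : ∀ S ∈ 𝒮, (S ∩ {x | l x = t}).encard ≤ 2 := fun S hS =>
    (h𝒮 S hS).encard_inter_le l t (htb S hS)
  have hZcard : Z.card ≤ hfin.toFinset.card * 2 := by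
    apply Finset.card_biUnion_le_card_mul
    intro S hS
    have h2 := hfin2 S (by simpa using hS)
    have hf : (S ∩ {x | l x = t}).Finite := Set.finite_of_encard_le_coe h2
    rw [dif_pos hf]
    rw [hf.encard_eq_coe_toFinset_card] at h2
    exact_mod_cast h2
  rw [Set.ncard_eq_toFinset_card _ hfin, mul_comm]
  refine le_trans (Finset.card_le_card_of_injOn X ?_ ?_) hZcard
  · intro q hq
    obtain ⟨S, hS, hxS⟩ := hcov (Or.inr (Set.mem_iUnion.2 ⟨_, hX q hq⟩))
    have hf : (S ∩ {x | l x = t}).Finite := Set.finite_of_encard_le_coe (hfin2 S hS)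
    simp only [hZ, Finset.coe_biUnion, Set.mem_iUnion]
    refine ⟨S, by simpa using hS, ?_⟩
    rw [dif_pos hf]
    simpa using ⟨hxS, hXt q hq⟩
  · intro q hq q' hq' hqq
    by_contra hne
    have hee : (⟨s(q.1, q.2), G.mem_edgeSet.2 (hadj q hq)⟩ : G.edgeSet) ≠
        ⟨s(q'.1, q'.2), G.mem_edgeSet.2 (hadj q' hq')⟩ := by
      intro he
      have he' := congrArg Subtype.val he
      simp only [Sym2.eq_iff] at he'
      simp only [Finset.coe_filter, Finset.mem_product, Finset.mem_compl, Set.mem_ofPred_eq] at hq hq'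
      rcases he' with he' | he'
      · exact hne (Prod.ext he'.1 he'.2)
      · exact hq'.1.2 (he'.1 ▸ hq.1.1)
    -- A point shared by two edges is a vertex, and no vertex lies at level `t`.
    obtain ⟨v, -, -, hv⟩ := D.crossing_free _ _ hee (X q) ⟨hX q hq, hqq ▸ hX q' hq'⟩
    exact hpos v (hv ▸ hXt q hq)

lemma ArcDrawing.sq_le_of_complete {n d : ℕ} (hn : 0 < n)
    (D : ArcDrawing (SimpleGraph.completeGraph (Fin n)) d)
    {𝒮 : Set (Set (EuclideanSpace ℝ (Fin d)))}
    (hfin : 𝒮.Finite) (h𝒮 : ∀ S ∈ 𝒮, IsRoundSphere 1 d S) (hcov : D.carrier ⊆ ⋃₀ 𝒮) :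
    n ^ 2 ≤ 8 * 𝒮.ncard + 1 := by
  classical
  obtain ⟨l, hl⟩ := exists_functional_injective D.pos_injective
  obtain ⟨m, hm⟩ := exists_card_filter_lt_eq hl (a := n / 2) (by simp; omega)
  set T := Finset.univ.filter fun v => l (D.pos v) < l (D.pos m) with hT
  have hcr := D.card_crossing_le hfin h𝒮 hcov l T (by
    intro v hv w hw
    simp only [hT, Finset.mem_filter, Finset.mem_univ, true_and, not_lt] at hv hw
    exact hv.trans_le hw)
  rw [Finset.filter_true_of_mem, Finset.card_product, Finset.card_compl, hm,
    Fintype.card_fin] at hcr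
  · obtain ⟨k, rfl | rfl⟩ := Nat.even_or_odd' n
    · rw [show 2 * k / 2 = k by omega, show 2 * k - k = k by omega] at hcr
      nlinarith
    · rw [show (2 * k + 1) / 2 = k by omega, show 2 * k + 1 - k = k + 1 by omega] at hcr
      nlinarith
  · rintro ⟨v, w⟩ hq
    simp only [Finset.mem_product, Finset.mem_compl] at hq
    simp only [SimpleGraph.completeGraph, SimpleGraph.top_adj]
    rintro rfl
    exact hq.2 hq.1

lemma card_crossing_completeBipartite {p q : ℕ} (T : Finset (Fin p ⊕ Fin q))
    [DecidableRel (completeBipartiteGraph (Fin p) (Fin q)).Adj] :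
    ((T ×ˢ Tᶜ).filter fun x => (completeBipartiteGraph (Fin p) (Fin q)).Adj x.1 x.2).card =
      T.toLeft.card * (q - T.toRight.card) + T.toRight.card * (p - T.toLeft.card) := by
  have : ((T ×ˢ Tᶜ).filter fun x => (completeBipartiteGraph (Fin p) (Fin q)).Adj x.1 x.2) =
      (T.toLeft ×ˢ T.toRightᶜ).map (Function.Embedding.inl.prodMap Function.Embedding.inr) ∪
      (T.toRight ×ˢ T.toLeftᶜ).map (Function.Embedding.inr.prodMap Function.Embedding.inl) := by
    ext ⟨v, w⟩
    rcases v with v | v <;> rcases w with w | w <;> simp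
  rw [this, Finset.card_union_of_disjoint]
  · simp [Finset.card_compl]
  · rw [Finset.disjoint_left]
    rintro ⟨v, w⟩ h1 h2
    rcases v with v | v <;> simp at h1 h2

lemma ArcDrawing.mul_le_of_completeBipartite {p q d : ℕ} (hp : 0 < p)
    (D : ArcDrawing (completeBipartiteGraph (Fin p) (Fin q)) d)
    {𝒮 : Set (Set (EuclideanSpace ℝ (Fin d)))}
    (hfin : 𝒮.Finite) (h𝒮 : ∀ S ∈ 𝒮, IsRoundSphere 1 d S) (hcov : D.carrier ⊆ ⋃₀ 𝒮) :
    p * q ≤ 4 * 𝒮.ncard := by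
  classical
  obtain ⟨l, hl⟩ := exists_functional_injective D.pos_injective
  -- `m` is a median of the left part. `T` and `T'` are the cuts just below and just above it; they
  -- differ only in `m`.
  obtain ⟨m, hm⟩ := exists_card_filter_lt_eq (hl.comp Sum.inl_injective) (a := p / 2)
    (by simp; omega)
  simp only [Function.comp_apply] at hm
  set T := Finset.univ.filter fun v => l (D.pos v) < l (D.pos (Sum.inl m)) with hT
  set T' := Finset.univ.filter fun v => l (D.pos v) ≤ l (D.pos (Sum.inl m)) with hT'
  have h1 := D.card_crossing_le hfin h𝒮 hcov l T (by
    intro v hv w hw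
    simp only [hT, Finset.mem_filter, Finset.mem_univ, true_and, not_lt] at hv hw
    exact hv.trans_le hw)
  have h2 := D.card_crossing_le hfin h𝒮 hcov l T' (by
    intro v hv w hw
    simp only [hT', Finset.mem_filter, Finset.mem_univ, true_and, not_le] at hv hw
    exact hv.trans_lt hw)
  replace h1 := (card_crossing_completeBipartite T).symm.trans_le h1
  replace h2 := (card_crossing_completeBipartite T').symm.trans_le h2
  have e1 : T.toLeft.card = p / 2 := by
    rw [← hm]
    congr 1
    ext v
    simp [hT]
  have e2 : T'.toLeft.card = p / 2 + 1 := by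
    have : T'.toLeft = insert m T.toLeft := by
      ext v
      simp only [hT, hT', Finset.mem_toLeft, Finset.mem_filter, Finset.mem_univ, true_and,
        Finset.mem_insert, le_iff_lt_or_eq]
      rw [or_comm]
      exact or_congr_left ⟨fun h => Sum.inl_injective (hl h), fun h => h ▸ rfl⟩
    rw [this, Finset.card_insert_of_notMem (by simp [hT]), e1]
  have e3 : T'.toRight = T.toRight := by
    ext v
    simp only [hT, hT', Finset.mem_toRight, Finset.mem_filter, Finset.mem_univ, true_and]
    exact ⟨fun h => lt_of_le_of_ne h fun h' => by simpa using hl h', le_of_lt⟩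
  have hB : T.toRight.card ≤ q := by simpa using Finset.card_le_univ T.toRight
  rw [e1] at h1
  rw [e2, e3] at h2
  generalize T.toRight.card = B at *
  obtain ⟨B', rfl⟩ := Nat.exists_eq_add_of_le hB
  rw [Nat.add_sub_cancel_left] at h1 h2
  obtain ⟨k, rfl | rfl⟩ := Nat.even_or_odd' p
  · rw [show 2 * k / 2 = k by omega, show 2 * k - k = k by omega] at h1
    nlinarith
  -- For odd `p` one cut alone depends on how the right part is split; in the sum of the two bounds
  -- that dependence cancels, leaving `(2k+1)q`.
  · rw [show (2 * k + 1) / 2 = k by omega, show 2 * k + 1 - k = k + 1 by omega] at h1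
    rw [show (2 * k + 1) / 2 = k by omega, show 2 * k + 1 - (k + 1) = k by omega] at h2
    nlinarith

/-! ### Half-space sections of circles as arcs -/

open scoped InnerProductSpace

set_option maxHeartbeats 400000 in
/-- The part of a circle that lies in a closed half-space, if its boundary meets the circle in two
distinct points `a` and `b`, is a circular arc from `a` to `b`. -/
lemma isCircularArc_halfSpace {F : Submodule ℝ (EuclideanSpace ℝ (Fin d))}
    (hF : Module.finrank ℝ F = 2) {c n a b : EuclideanSpace ℝ (Fin d)} {r k : ℝ}
    (hc : c ∈ F) (hr : 0 < r) (hn : n ∈ F) (hn0 : n ≠ 0)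
    (ha : a ∈ F) (hb : b ∈ F) (har : ‖a - c‖ = r) (hbr : ‖b - c‖ = r) (hab : a ≠ b)
    (hak : ⟪n, a⟫_ℝ = k) (hbk : ⟪n, b⟫_ℝ = k) :
    IsCircularArc {x | x ∈ F ∧ ‖x - c‖ = r ∧ k ≤ ⟪n, x⟫_ℝ} a b := by
  have hnn : 0 < ‖n‖ := norm_pos_iff.2 hn0
  obtain ⟨u₀, hu₀⟩ : ∃ y, y = (r / ‖n‖) • n := ⟨_, rfl⟩
  have hu₀n : ‖u₀‖ = r := by
    rw [hu₀, norm_smul, Real.norm_of_nonneg (by positivity)]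
    field_simp
  -- The chord lies at signed distance `r * C` from `c` in the direction `u₀`, so `C` is the cosine
  -- of half the angle of the arc.
  obtain ⟨C, hC⟩ : ∃ y, y = (k - ⟪n, c⟫_ℝ) / (‖n‖ * r) := ⟨_, rfl⟩
  have hinner : ∀ x, ⟪u₀, x - c⟫_ℝ = r ^ 2 * C + r / ‖n‖ * (⟪n, x⟫_ℝ - k) := by
    intro x
    rw [hu₀, real_inner_smul_left, inner_sub_right, hC]
    field_simp
    ring
  have hau : ⟪u₀, a - c⟫_ℝ = r ^ 2 * C := by rw [hinner, hak]; ring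
  have hbu : ⟪u₀, b - c⟫_ℝ = r ^ 2 * C := by rw [hinner, hbk]; ring
  have hrem : ∀ x, ⟪u₀, x - c⟫_ℝ = r ^ 2 * C → ‖x - c‖ = r →
      ‖c + C • u₀ - x‖ ^ 2 = r ^ 2 * (1 - C ^ 2) := by
    intro x hx hxr
    rw [show c + C • u₀ - x = C • u₀ - (x - c) by abel, norm_sub_sq_real, real_inner_smul_left, hx,
      norm_smul, mul_pow, hu₀n, hxr, Real.norm_eq_abs, sq_abs]
    ring
  have hr2 : 0 < r ^ 2 := by positivity
  -- Otherwise the line of the chord is at best tangent to the circle, forcing `a = b`.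
  have hC1 : 0 < 1 - C ^ 2 := by
    by_contra! h
    have h1 : ∀ x, ⟪u₀, x - c⟫_ℝ = r ^ 2 * C → ‖x - c‖ = r → c + C • u₀ = x := by
      intro x hx hxr
      have := hrem x hx hxr
      have h2 : ‖c + C • u₀ - x‖ ^ 2 = 0 := le_antisymm (by nlinarith) (sq_nonneg _)
      exact sub_eq_zero.1 (norm_eq_zero.1 (pow_eq_zero_iff two_ne_zero |>.1 h2))
    exact hab ((h1 a hau har).symm.trans (h1 b hbu hbr))
  have hCl : -1 < C := by nlinarith
  have hCu : C < 1 := by nlinarith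
  obtain ⟨δ, hδ⟩ : ∃ y, y = Real.arccos C := ⟨_, rfl⟩
  have hδ0 : 0 < δ := hδ ▸ Real.arccos_pos.2 hCu
  have hδπ : δ < Real.pi := by
    rw [hδ, ← Real.arccos_neg_one]
    exact Real.strictAntiOn_arccos (by simp) ⟨hCl.le, hCu.le⟩ hCl
  have hcos : Real.cos δ = C := hδ ▸ Real.cos_arccos hCl.le hCu.le
  have hsin : 0 < Real.sin δ := Real.sin_pos_of_pos_of_lt_pi hδ0 hδπ
  have hsc : Real.sin δ ^ 2 = 1 - C ^ 2 := by rw [Real.sin_sq, hcos]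
  -- The sign puts `a` at angle `-δ` in the frame `u₀, v₀`; the arc is then the range from `-δ` to
  -- `δ`.
  obtain ⟨v₀, hv₀⟩ : ∃ y, y = (1 / Real.sin δ) • (c + C • u₀ - a) := ⟨_, rfl⟩
  have hv₀' : Real.sin δ • v₀ = c + C • u₀ - a := by
    rw [hv₀, smul_smul, mul_one_div_cancel hsin.ne', one_smul]
  have hv₀n : ‖v₀‖ = r := by
    have : ‖v₀‖ ^ 2 = r ^ 2 := by
      rw [hv₀, norm_smul, mul_pow, hrem a hau har, ← hsc, Real.norm_eq_abs, sq_abs]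
      field_simp
    exact (pow_left_inj₀ (norm_nonneg _) hr.le two_ne_zero).1 this
  have huv : ⟪u₀, v₀⟫_ℝ = 0 := by
    rw [hv₀, real_inner_smul_right, show c + C • u₀ - a = C • u₀ - (a - c) by abel, inner_sub_right,
      hau, real_inner_smul_right, real_inner_self_eq_norm_sq, hu₀n]
    ring
  have hu₀F : u₀ ∈ F := hu₀ ▸ F.smul_mem _ hn
  have hv₀F : v₀ ∈ F := hv₀ ▸ F.smul_mem _ (F.sub_mem (F.add_mem hc (F.smul_mem _ hu₀F)) ha)
  have hlin : LinearIndependent ℝ ![u₀, v₀] := by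
    rw [LinearIndependent.pair_iff]
    intro s t hst
    have h1 := congrArg (fun x => ⟪u₀, x⟫_ℝ) hst
    have h2 := congrArg (fun x => ⟪v₀, x⟫_ℝ) hst
    simp only [inner_add_right, real_inner_smul_right, huv, real_inner_comm u₀ v₀,
      real_inner_self_eq_norm_sq, hu₀n, hv₀n, inner_zero_right] at h1 h2
    constructor
    · nlinarith
    · nlinarith
  have hspan : ∀ x ∈ F, ∃ s t : ℝ, x = s • u₀ + t • v₀ := by
    intro x hx
    have : Submodule.span ℝ (Set.range ![u₀, v₀]) = F := by
      apply Submodule.eq_of_le_of_finrank_eq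
      · rw [Submodule.span_le]
        rintro _ ⟨i, rfl⟩
        fin_cases i <;> assumption
      · rw [finrank_span_eq_card hlin, hF]; simp
    rw [← this, Matrix.range_cons, Matrix.range_cons, Matrix.range_empty, Set.union_empty,
      Set.singleton_union, Submodule.mem_span_pair] at hx
    obtain ⟨s, t, h⟩ := hx
    exact ⟨s, t, h.symm⟩
  have hnorm : ∀ s t : ℝ, ‖s • u₀ + t • v₀‖ ^ 2 = r ^ 2 * (s ^ 2 + t ^ 2) := by
    intro s t
    rw [norm_add_sq_real, real_inner_smul_left, real_inner_smul_right, huv, norm_smul, norm_smul,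
      mul_pow, mul_pow, hu₀n, hv₀n, Real.norm_eq_abs, Real.norm_eq_abs, sq_abs, sq_abs]
    ring
  -- The frame is rotated by `-δ` so that the arc starts at parameter `0`.
  obtain ⟨u, hu⟩ : ∃ y, y = Real.cos δ • u₀ - Real.sin δ • v₀ := ⟨_, rfl⟩
  obtain ⟨v, hv⟩ : ∃ y, y = Real.sin δ • u₀ + Real.cos δ • v₀ := ⟨_, rfl⟩
  have hpoint : ∀ s, circlePoint c u v (s + δ) = c + Real.cos s • u₀ + Real.sin s • v₀ := by
    intro s
    have h1 : Real.cos s = Real.cos (s + δ) * Real.cos δ + Real.sin (s + δ) * Real.sin δ := by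
      rw [← Real.cos_sub]; simp
    have h2 : Real.sin s = Real.sin (s + δ) * Real.cos δ - Real.cos (s + δ) * Real.sin δ := by
      rw [← Real.sin_sub]; simp
    rw [circlePoint, hu, hv, h1, h2]
    module
  have hun : ‖u‖ = r := by
    have : ‖u‖ ^ 2 = r ^ 2 := by
      rw [hu, sub_eq_add_neg, ← neg_smul, hnorm, neg_sq, Real.cos_sq_add_sin_sq, mul_one]
    exact (pow_left_inj₀ (norm_nonneg _) hr.le two_ne_zero).1 this
  have hvn : ‖v‖ = r := by
    have : ‖v‖ ^ 2 = r ^ 2 := by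
      rw [hv, hnorm, Real.sin_sq_add_cos_sq, mul_one]
    exact (pow_left_inj₀ (norm_nonneg _) hr.le two_ne_zero).1 this
  refine ⟨c, u, v, 2 * δ, ?_, hun.trans hvn.symm, ?_, by linarith, by linarith, ?_, ?_, ?_⟩
  · rw [← norm_ne_zero_iff, hun]; exact hr.ne'
  · simp only [hu, hv, inner_sub_left, inner_add_right, real_inner_smul_left,
      real_inner_smul_right, huv, real_inner_comm u₀ v₀, real_inner_self_eq_norm_sq, hu₀n, hv₀n]
    ring
  · have := hpoint (-δ)
    rw [neg_add_cancel, Real.cos_neg, Real.sin_neg, hcos, neg_smul, hv₀'] at this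
    rw [this]; abel
  · have := hpoint δ
    rw [two_mul, this, hcos, hv₀']
    obtain ⟨s, t, hst⟩ := hspan (b - c) (F.sub_mem hb hc)
    have hs : s = C := by
      have := hbu
      rw [hst, inner_add_right, real_inner_smul_right, real_inner_smul_right, huv,
        real_inner_self_eq_norm_sq, hu₀n] at this
      exact mul_left_cancel₀ hr2.ne' (by linarith)
    have hac : a - c = C • u₀ - Real.sin δ • v₀ := by rw [hv₀']; abel
    have ht : t ^ 2 = Real.sin δ ^ 2 := by
      have h := hnorm s t
      rw [← hst, hbr, hs] at h
      have := mul_left_cancel₀ hr2.ne' ((mul_one (r ^ 2)).trans h)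
      linarith
    rcases sq_eq_sq_iff_eq_or_eq_neg.1 ht with h | h
    · rw [h, hs, hv₀'] at hst
      rw [← sub_eq_zero] at hst ⊢
      rw [← hst]; abel
    · exfalso
      apply hab
      rw [h, hs, neg_smul, ← sub_eq_add_neg, ← hac] at hst
      exact (sub_left_inj.1 hst).symm
  · ext x
    simp only [Set.mem_ofPred_eq, Set.mem_image, Set.mem_Icc]
    have hiff : ∀ s t : ℝ, x - c = s • u₀ + t • v₀ → (k ≤ ⟪n, x⟫_ℝ ↔ C ≤ s) := by
      intro s t hst
      have := hinner x
      rw [hst, inner_add_right, real_inner_smul_right, real_inner_smul_right, huv,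
        real_inner_self_eq_norm_sq, hu₀n] at this
      have hrn : 0 < r / ‖n‖ := by positivity
      have h : r / ‖n‖ * (⟪n, x⟫_ℝ - k) = r ^ 2 * (s - C) := by linarith
      rw [← sub_nonneg, ← mul_nonneg_iff_of_pos_left hrn, h, mul_nonneg_iff_of_pos_left hr2,
        sub_nonneg]
    constructor
    · rintro ⟨hxF, hxr, hxk⟩
      obtain ⟨s, t, hst⟩ := hspan (x - c) (F.sub_mem hxF hc)
      have h1 : s ^ 2 + t ^ 2 = 1 := by
        have h := hnorm s t
        rw [← hst, hxr] at h
        exact (mul_left_cancel₀ hr2.ne' ((mul_one (r ^ 2)).trans h)).symm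
      have hsC := (hiff s t hst).1 hxk
      have hs1 : s ≤ 1 := by nlinarith [sq_nonneg t]
      have hs2 : -1 ≤ s := by nlinarith [sq_nonneg t]
      have hle : Real.arccos s ≤ δ := hδ ▸ Real.arccos_le_arccos hsC
      have h0 := Real.arccos_nonneg s
      have hsin' : Real.sin (Real.arccos s) ^ 2 = t ^ 2 := by
        rw [Real.sin_sq, Real.cos_arccos hs2 hs1]; linarith
      rcases sq_eq_sq_iff_eq_or_eq_neg.1 hsin' with h | h
      · refine ⟨Real.arccos s + δ, ⟨by linarith, by linarith⟩, ?_⟩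
        rw [hpoint, Real.cos_arccos hs2 hs1, h, add_assoc, ← hst]; abel
      · refine ⟨-Real.arccos s + δ, ⟨by linarith, by linarith⟩, ?_⟩
        rw [hpoint, Real.cos_neg, Real.sin_neg, Real.cos_arccos hs2 hs1, h, neg_neg, add_assoc,
          ← hst]
        abel
    · rintro ⟨t, ⟨ht0, ht1⟩, rfl⟩
      have hp := hpoint (t - δ)
      rw [sub_add_cancel] at hp
      have hpc : circlePoint c u v t - c = Real.cos (t - δ) • u₀ + Real.sin (t - δ) • v₀ := by
        rw [hp]; abel
      refine ⟨?_, ?_, ?_⟩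
      · rw [hp]
        exact F.add_mem (F.add_mem hc (F.smul_mem _ hu₀F)) (F.smul_mem _ hv₀F)
      · rw [hpc, ← pow_left_inj₀ (norm_nonneg _) hr.le two_ne_zero, hnorm, Real.cos_sq_add_sin_sq,
          mul_one]
      · rw [hiff _ _ hpc, ← hcos, ← Real.cos_abs (t - δ)]
        exact Real.cos_le_cos_of_nonneg_of_le_pi (abs_nonneg _) hδπ.le
          (abs_le.2 ⟨by linarith, by linarith⟩)

/-! ### Circles of `ℝᵈ` as linear planes under stereographic projection -/

/-- The direction of the stereographic preimage of `x` in `ℝᵈ × ℝ`. -/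
noncomputable def lift (x : EuclideanSpace ℝ (Fin d)) : EuclideanSpace ℝ (Fin d) × ℝ :=
  (x, (‖x‖ ^ 2 - 1) / 2)

/-- The stereographic projection of the direction `a`. -/
noncomputable def proj (a : EuclideanSpace ℝ (Fin d) × ℝ) : EuclideanSpace ℝ (Fin d) :=
  (√(‖a.1‖ ^ 2 + a.2 ^ 2) - a.2)⁻¹ • a.1

lemma lift_ne_zero (x : EuclideanSpace ℝ (Fin d)) : lift x ≠ 0 := by
  intro h
  obtain ⟨h1, h2⟩ := Prod.ext_iff.1 h
  simp only [lift, Prod.fst_zero, Prod.snd_zero] at h1 h2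
  simp [h1] at h2

lemma lift_eq_iff {x : EuclideanSpace ℝ (Fin d)} {a b : EuclideanSpace ℝ (Fin d) × ℝ} {α β : ℝ} :
    lift x = α • a + β • b ↔
      x = α • a.1 + β • b.1 ∧ (‖x‖ ^ 2 - 1) / 2 = α * a.2 + β * b.2 := by
  simp [lift, Prod.ext_iff]

lemma lt_sqrt_normSq_add {a : EuclideanSpace ℝ (Fin d) × ℝ} (ha : a.1 ≠ 0) :
    a.2 < √(‖a.1‖ ^ 2 + a.2 ^ 2) := by
  have : 0 < ‖a.1‖ := norm_pos_iff.2 ha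
  exact Real.lt_sqrt_of_sq_lt (by nlinarith)

/-- A lifted point has Euclidean length `(‖x‖ ^ 2 + 1) / 2`, so its length minus its last coordinate
is `1`. This normalisation dictates the scaling factor. -/
lemma lift_proj {a : EuclideanSpace ℝ (Fin d) × ℝ} (ha : a.1 ≠ 0) :
    lift (proj a) = (√(‖a.1‖ ^ 2 + a.2 ^ 2) - a.2)⁻¹ • a := by
  have h := sub_pos.2 (lt_sqrt_normSq_add ha)
  have hs : √(‖a.1‖ ^ 2 + a.2 ^ 2) ^ 2 = ‖a.1‖ ^ 2 + a.2 ^ 2 := Real.sq_sqrt (by positivity)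
  refine Prod.ext rfl ?_
  simp only [lift, proj, norm_smul, Prod.smul_snd, smul_eq_mul, norm_inv, Real.norm_of_nonneg h.le]
  field_simp
  linear_combination -hs

lemma exists_lift_proj {a : EuclideanSpace ℝ (Fin d) × ℝ} (ha : a.1 ≠ 0) :
    ∃ μ : ℝ, 0 < μ ∧ lift (proj a) = μ • a :=
  ⟨_, inv_pos.2 (sub_pos.2 (lt_sqrt_normSq_add ha)), lift_proj ha⟩

lemma eq_proj {a : EuclideanSpace ℝ (Fin d) × ℝ} (ha : a.1 ≠ 0) {x : EuclideanSpace ℝ (Fin d)}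
    {μ : ℝ} (hμ : 0 < μ) (hx : lift x = μ • a) : x = proj a := by
  obtain ⟨ν, hν, hy⟩ := exists_lift_proj ha
  have key : ∀ {x : EuclideanSpace ℝ (Fin d)} {μ : ℝ}, lift x = μ • a →
      x = μ • a.1 ∧ μ ^ 2 * ‖a.1‖ ^ 2 - 1 = 2 * μ * a.2 := by
    intro x μ hx
    have h1 : x = μ • a.1 := congrArg Prod.fst hx
    have h2 : (‖x‖ ^ 2 - 1) / 2 = μ * a.2 := congrArg Prod.snd hx
    refine ⟨h1, ?_⟩
    rw [h1, norm_smul, mul_pow, Real.norm_eq_abs, sq_abs] at h2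
    linarith
  obtain ⟨hx1, hx2⟩ := key hx
  obtain ⟨hy1, hy2⟩ := key hy
  -- Eliminating `a.2` from the two quadratic equations leaves a product whose second factor is
  -- positive.
  have h : (μ - ν) * (μ * ν * ‖a.1‖ ^ 2 + 1) = 0 := by linear_combination ν * hx2 - μ * hy2
  have hpos : 0 < μ * ν * ‖a.1‖ ^ 2 + 1 := by positivity
  rw [hx1, hy1, sub_eq_zero.1 ((mul_eq_zero.1 h).resolve_right hpos.ne')]

/-- The Gram determinant is positive because `q` has a nonzero component orthogonal to `p`. -/
lemma gram_pos {p q : EuclideanSpace ℝ (Fin d)} (h : LinearIndependent ℝ ![p, q]) :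
    0 < ‖p‖ ^ 2 * ‖q‖ ^ 2 - ⟪p, q⟫_ℝ ^ 2 := by
  have hp : p ≠ 0 := h.ne_zero 0
  have h1 : ‖p‖ ^ 2 • q - ⟪p, q⟫_ℝ • p ≠ 0 := by
    intro h0
    rw [LinearIndependent.pair_iff] at h
    have := (h (-⟪p, q⟫_ℝ) (‖p‖ ^ 2) (by rw [← h0]; module)).2
    simp [hp] at this
  have h2 : 0 < ‖‖p‖ ^ 2 • q - ⟪p, q⟫_ℝ • p‖ ^ 2 := by positivity
  rw [norm_sub_sq_real, real_inner_smul_left, real_inner_smul_right, norm_smul, norm_smul,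
    real_inner_comm, Real.norm_eq_abs, Real.norm_eq_abs, mul_pow, mul_pow, sq_abs, sq_abs] at h2
  have hp2 : 0 < ‖p‖ ^ 2 := by positivity
  by_contra! hle
  rw [real_inner_comm q p] at hle
  nlinarith

lemma exists_mem_span_inner_eq {p q : EuclideanSpace ℝ (Fin d)}
    (h : LinearIndependent ℝ ![p, q]) (s t : ℝ) :
    ∃ c ∈ Submodule.span ℝ {p, q}, ⟪c, p⟫_ℝ = s ∧ ⟪c, q⟫_ℝ = t := by
  have hD := gram_pos h
  set D := ‖p‖ ^ 2 * ‖q‖ ^ 2 - ⟪p, q⟫_ℝ ^ 2 with hDdef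
  -- Cramer's rule for the Gram matrix of `p` and `q`.
  refine ⟨((s * ‖q‖ ^ 2 - t * ⟪p, q⟫_ℝ) / D) • p + ((t * ‖p‖ ^ 2 - s * ⟪p, q⟫_ℝ) / D) • q,
    Submodule.mem_span_pair.2 ⟨_, _, rfl⟩, ?_, ?_⟩
  · rw [inner_add_left, real_inner_smul_left, real_inner_smul_left, real_inner_self_eq_norm_sq,
      real_inner_comm p q]
    field_simp
    rw [hDdef]; ring
  · rw [inner_add_left, real_inner_smul_left, real_inner_smul_left, real_inner_self_eq_norm_sq]
    field_simp
    rw [hDdef]; ring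

/-- On the span of `a.1` and `b.1` the last coordinate of the plane is the functional `⟪c, ·⟫`. The
equation `(‖x‖ ^ 2 - 1) / 2 = ⟪x, c⟫` becomes that of a sphere about `c` after completing the
square. -/
lemma lift_mem_span_iff {a b : EuclideanSpace ℝ (Fin d) × ℝ} {c : EuclideanSpace ℝ (Fin d)}
    (ha : ⟪c, a.1⟫_ℝ = a.2) (hb : ⟪c, b.1⟫_ℝ = b.2) {x : EuclideanSpace ℝ (Fin d)} {α β : ℝ} :
    lift x = α • a + β • b ↔ x = α • a.1 + β • b.1 ∧ ‖x - c‖ = √(1 + ‖c‖ ^ 2) := by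
  rw [lift_eq_iff]
  refine and_congr_right fun hx => ?_
  have h1 : α * a.2 + β * b.2 = ⟪x, c⟫_ℝ := by
    rw [hx, real_inner_comm, inner_add_right, real_inner_smul_right, real_inner_smul_right, ha, hb]
  rw [h1, eq_comm (b := √(1 + ‖c‖ ^ 2)), Real.sqrt_eq_iff_eq_sq (by positivity) (norm_nonneg _),
    norm_sub_sq_real]
  constructor <;> intro h <;> linarith

lemma finrank_span_pair_eq_two {p q : EuclideanSpace ℝ (Fin d)}
    (h : LinearIndependent ℝ ![p, q]) : Module.finrank ℝ (Submodule.span ℝ {p, q}) = 2 := by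
  have := finrank_span_eq_card h
  rwa [Matrix.range_cons, Matrix.range_cons, Matrix.range_empty, Set.union_empty,
    Set.singleton_union, Fintype.card_fin] at this

/-- Independence of the first components says that the plane misses the axis of the poles, so that
its image is a circle and not a line. -/
lemma isRoundSphere_lift {a b : EuclideanSpace ℝ (Fin d) × ℝ}
    (h : LinearIndependent ℝ ![a.1, b.1]) :
    IsRoundSphere 1 d {x | ∃ α β : ℝ, lift x = α • a + β • b} := by
  obtain ⟨c, hc, hca, hcb⟩ := exists_mem_span_inner_eq h a.2 b.2
  refine ⟨(Submodule.span ℝ {a.1, b.1}).toAffineSubspace, c, √(1 + ‖c‖ ^ 2),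
    by simpa using hc, ?_, by positivity, ?_⟩
  · rw [Submodule.toAffineSubspace_direction, finrank_span_pair_eq_two h]
  · ext x
    simp only [Set.mem_ofPred_eq, lift_mem_span_iff hca hcb, Submodule.mem_toAffineSubspace,
      Submodule.mem_span_pair, dist_eq_norm]
    constructor
    · rintro ⟨α, β, hx, hn⟩
      exact ⟨⟨α, β, hx.symm⟩, hn⟩
    · rintro ⟨⟨α, β, hx⟩, hn⟩
      exact ⟨α, β, hx.symm, hn⟩

/-- The part of the circle spanned by `a` and `b` that is cut out by a linear inequality in the
coordinates is a circular arc. -/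
lemma isCircularArc_lift {a b : EuclideanSpace ℝ (Fin d) × ℝ}
    (h : LinearIndependent ℝ ![a.1, b.1]) {s t k : ℝ} (hst : s ≠ 0 ∨ t ≠ 0)
    {y z : EuclideanSpace ℝ (Fin d)} (hyz : y ≠ z) {α β γ δ : ℝ}
    (hy : lift y = α • a + β • b) (hyk : α * s + β * t = k)
    (hz : lift z = γ • a + δ • b) (hzk : γ * s + δ * t = k) :
    IsCircularArc {x | ∃ α β : ℝ, lift x = α • a + β • b ∧ k ≤ α * s + β * t} y z := by
  obtain ⟨c, hc, hca, hcb⟩ := exists_mem_span_inner_eq h a.2 b.2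
  obtain ⟨n, hn, hna, hnb⟩ := exists_mem_span_inner_eq h s t
  have hnx : ∀ α β : ℝ, ⟪n, α • a.1 + β • b.1⟫_ℝ = α * s + β * t := fun α β => by
    rw [inner_add_right, real_inner_smul_right, real_inner_smul_right, hna, hnb]
  have hn0 : n ≠ 0 := by
    rintro rfl
    rw [inner_zero_left] at hna hnb
    exact hst.elim (· hna.symm) (· hnb.symm)
  rw [lift_mem_span_iff hca hcb] at hy hz
  convert isCircularArc_halfSpace (finrank_span_pair_eq_two h) hc
    (Real.sqrt_pos.2 (by positivity : 0 < 1 + ‖c‖ ^ 2)) hn hn0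
    (Submodule.mem_span_pair.2 ⟨α, β, hy.1.symm⟩) (Submodule.mem_span_pair.2 ⟨γ, δ, hz.1.symm⟩)
    hy.2 hz.2 hyz ((hy.1 ▸ hnx α β).trans hyk) ((hz.1 ▸ hnx γ δ).trans hzk) using 1
  ext x
  simp only [Set.mem_ofPred_eq, lift_mem_span_iff hca hcb, Submodule.mem_span_pair]
  constructor
  · rintro ⟨α, β, ⟨hx, hxn⟩, hk⟩
    exact ⟨⟨α, β, hx.symm⟩, hxn, by rwa [hx, hnx]⟩
  · rintro ⟨⟨α, β, hx⟩, hxn, hk⟩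
    exact ⟨α, β, ⟨hx.symm, hxn⟩, by rwa [← hx, hnx] at hk⟩

lemma proj_ne_proj {a b : EuclideanSpace ℝ (Fin d) × ℝ}
    (h : LinearIndependent ℝ ![a.1, b.1]) : proj a ≠ proj b := by
  have ha : a.1 ≠ 0 := h.ne_zero 0
  have hb : b.1 ≠ 0 := h.ne_zero 1
  intro hab
  obtain ⟨μ, hμ, h1⟩ := exists_lift_proj ha
  obtain ⟨ν, hν, h2⟩ := exists_lift_proj hb
  rw [hab, h2] at h1
  have h3 : ν • b.1 = μ • a.1 := congrArg Prod.fst h1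
  rw [LinearIndependent.pair_iff] at h
  exact hν.ne' (neg_eq_zero.1 (h μ (-ν) (by rw [neg_smul, h3]; abel)).2)

lemma proj_neg_ne_proj {a : EuclideanSpace ℝ (Fin d) × ℝ} (ha : a.1 ≠ 0) :
    proj a ≠ proj (-a) := by
  intro hab
  obtain ⟨μ, hμ, h1⟩ := exists_lift_proj ha
  obtain ⟨ν, hν, h2⟩ := exists_lift_proj (a := -a) (by simpa using ha)
  rw [hab, h2] at h1
  have h3 : ν • (-a.1) = μ • a.1 := congrArg Prod.fst h1
  have h4 : (μ + ν) • a.1 = 0 := by rw [add_smul, ← h3]; module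
  rcases smul_eq_zero.1 h4 with h5 | h5
  · linarith
  · exact ha h5

lemma isCircularArc_halfCircle {a b : EuclideanSpace ℝ (Fin d) × ℝ}
    (h : LinearIndependent ℝ ![a.1, b.1]) :
    IsCircularArc {x | ∃ α β : ℝ, lift x = α • a + β • b ∧ 0 ≤ β} (proj a) (proj (-a)) := by
  have ha : a.1 ≠ 0 := h.ne_zero 0
  obtain ⟨μ, -, h1⟩ := exists_lift_proj ha
  obtain ⟨ν, -, h2⟩ := exists_lift_proj (a := -a) (by simpa using ha)
  simpa using isCircularArc_lift h (s := 0) (t := 1) (k := 0) (by simp) (proj_neg_ne_proj ha)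
    (α := μ) (β := 0) (γ := -ν) (δ := 0) (by simpa using h1) (by simp) (by simpa using h2) (by simp)

/-- The cone is a half-plane section in disguise: for independent `a` and `b`, the reverse-looking
condition `α‖a‖ + β‖b‖ ≥ ‖αa + βb‖` (Euclidean lengths in `ℝᵈ × ℝ`) singles out `α, β ≥ 0` among
nonzero combinations. On lifted points, length minus last coordinate is `1`, which makes this
condition linear in `α` and `β`. -/
lemma isCircularArc_cone {a b : EuclideanSpace ℝ (Fin d) × ℝ}
    (h : LinearIndependent ℝ ![a.1, b.1]) :
    IsCircularArc {x | ∃ α β : ℝ, lift x = α • a + β • b ∧ 0 ≤ α ∧ 0 ≤ β} (proj a) (proj b) := by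
  have ha : a.1 ≠ 0 := h.ne_zero 0
  have hb : b.1 ≠ 0 := h.ne_zero 1
  have hA := lt_sqrt_normSq_add ha
  have hB := lt_sqrt_normSq_add hb
  have h1 := lift_proj ha
  have h2 := lift_proj hb
  have hAs : √(‖a.1‖ ^ 2 + a.2 ^ 2) ^ 2 = ‖a.1‖ ^ 2 + a.2 ^ 2 := Real.sq_sqrt (by positivity)
  have hBs : √(‖b.1‖ ^ 2 + b.2 ^ 2) ^ 2 = ‖b.1‖ ^ 2 + b.2 ^ 2 := Real.sq_sqrt (by positivity)
  have hA0 : 0 < √(‖a.1‖ ^ 2 + a.2 ^ 2) :=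
    Real.sqrt_pos.2 (by have := norm_pos_iff.2 ha; positivity)
  have hB0 : 0 < √(‖b.1‖ ^ 2 + b.2 ^ 2) :=
    Real.sqrt_pos.2 (by have := norm_pos_iff.2 hb; positivity)
  generalize √(‖a.1‖ ^ 2 + a.2 ^ 2) = A at *
  generalize √(‖b.1‖ ^ 2 + b.2 ^ 2) = B at *
  -- Strict Cauchy–Schwarz in `ℝᵈ × ℝ`.
  have hAB : ⟪a.1, b.1⟫_ℝ + a.2 * b.2 < A * B := by
    have hg := gram_pos h
    have hn := sq_nonneg ‖b.2 • a.1 - a.2 • b.1‖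
    rw [norm_sub_sq_real, real_inner_smul_left, real_inner_smul_right, norm_smul, norm_smul,
      Real.norm_eq_abs, Real.norm_eq_abs, mul_pow, mul_pow, sq_abs, sq_abs] at hn
    apply lt_of_pow_lt_pow_left₀ 2 (by positivity)
    rw [mul_pow, hAs, hBs]
    nlinarith
  have := isCircularArc_lift h (s := A - a.2) (t := B - b.2) (k := 1) (Or.inl (sub_pos.2 hA).ne')
    (proj_ne_proj h) (α := (A - a.2)⁻¹) (β := 0) (γ := 0) (δ := (B - b.2)⁻¹) (by simpa using h1)
    (by rw [inv_mul_cancel₀ (sub_pos.2 hA).ne']; ring) (by simpa using h2)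
    (by rw [inv_mul_cancel₀ (sub_pos.2 hB).ne']; ring)
  convert this using 1
  ext x
  refine exists₂_congr fun α β => and_congr_right fun hx => ?_
  rw [lift_eq_iff] at hx
  obtain ⟨hx1, hx2⟩ := hx
  have hnorm : ‖x‖ ^ 2 = α ^ 2 * ‖a.1‖ ^ 2 + 2 * (α * β * ⟪a.1, b.1⟫_ℝ) + β ^ 2 * ‖b.1‖ ^ 2 := by
    rw [hx1, norm_add_sq_real, real_inner_smul_left, real_inner_smul_right, norm_smul, norm_smul,
      Real.norm_eq_abs, Real.norm_eq_abs, mul_pow, mul_pow, sq_abs, sq_abs]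
    ring
  -- `N` is the Euclidean length of `lift x`, equal to `(‖x‖ ^ 2 + 1) / 2`.
  set N := α * a.2 + β * b.2 + 1 with hN
  have hN0 : 0 < N := by nlinarith [sq_nonneg ‖x‖]
  have hNsq : (α * A + β * B) ^ 2 - N ^ 2 =
      2 * (α * β) * (A * B - (⟪a.1, b.1⟫_ℝ + a.2 * b.2)) := by
    have h3 : N ^ 2 = ‖x‖ ^ 2 + (α * a.2 + β * b.2) ^ 2 := by
      rw [hN]
      linear_combination -2 * hx2
    rw [h3, hnorm]
    linear_combination α ^ 2 * hAs + β ^ 2 * hBs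
  have hpos := sub_pos.2 hAB
  constructor
  · rintro ⟨hα, hβ⟩
    have h0 : N ^ 2 ≤ (α * A + β * B) ^ 2 := by
      have : 0 ≤ 2 * (α * β) * (A * B - (⟪a.1, b.1⟫_ℝ + a.2 * b.2)) := by positivity
      linarith
    have := le_of_sq_le_sq h0 (by positivity)
    linarith
  · intro hle
    have hle' : N ≤ α * A + β * B := by linarith
    have h0 : N ^ 2 ≤ (α * A + β * B) ^ 2 := by gcongr
    have h1 : 0 ≤ α * β := by
      by_contra! hneg
      nlinarith
    rcases le_or_gt 0 α with hα | hα
    · rcases le_or_gt 0 β with hβ | hβ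
      · exact ⟨hα, hβ⟩
      · nlinarith
    · nlinarith

/-! ### General position on the moment curve -/

/-- The moment curve in `ℝ⁴ = ℝ³ × ℝ`. -/
noncomputable def momentVec (t : ℝ) : EuclideanSpace ℝ (Fin 3) × ℝ := (!₂[1, t, t ^ 2], t ^ 3)

lemma linearIndependent_momentVec {s t : ℝ} (hst : s ≠ t) {e f : ℝ} (he : e ≠ 0) (hf : f ≠ 0) :
    LinearIndependent ℝ ![(e • momentVec s).1, (f • momentVec t).1] := by
  rw [LinearIndependent.pair_iff]
  intro a b hab
  have h0 := congrArg (fun x : EuclideanSpace ℝ (Fin 3) => x 0) hab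
  have h1 := congrArg (fun x : EuclideanSpace ℝ (Fin 3) => x 1) hab
  simp [momentVec] at h0 h1
  have h2 : b * f * (t - s) = 0 := by linear_combination h1 - s * h0
  have hb : b = 0 := by simpa [hf, sub_ne_zero.2 hst.symm] using h2
  subst hb
  simpa [he] using h0

lemma momentVec_fst_ne_zero (t : ℝ) {e : ℝ} (he : e ≠ 0) : (e • momentVec t).1 ≠ 0 :=
  (linearIndependent_momentVec (lt_add_one t).ne he one_ne_zero).ne_zero 0

/-- A vanishing combination annihilates all polynomials of degree below four. Testing it on the one
that vanishes on `S` except at `k` isolates the coefficient of `k`. -/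
lemma eq_zero_of_sum_momentVec_eq_zero {ι : Type*} [Fintype ι] {t : ι → ℝ}
    (ht : Function.Injective t) {c : ι → ℝ} (hc : ∑ k, c k • momentVec (t k) = 0) (S : Finset ι)
    (hS : S.card ≤ 4) (hcS : ∀ k ∉ S, c k = 0) : c = 0 := by
  classical
  have hpow : ∀ i < 4, ∑ k, c k * t k ^ i = 0 := by
    have h1 := congrArg Prod.fst hc
    have h2 := congrArg Prod.snd hc
    have h10 := congrArg (fun x : EuclideanSpace ℝ (Fin 3) => x 0) h1
    have h11 := congrArg (fun x : EuclideanSpace ℝ (Fin 3) => x 1) h1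
    have h12 := congrArg (fun x : EuclideanSpace ℝ (Fin 3) => x 2) h1
    simp [momentVec, Prod.fst_sum, Prod.snd_sum] at h10 h11 h12 h2
    intro i hi
    interval_cases i <;> simpa
  have hpoly : ∀ P : Polynomial ℝ, P.natDegree < 4 → ∑ k, c k * P.eval (t k) = 0 := by
    intro P hP
    simp_rw [Polynomial.eval_eq_sum_range' hP, Finset.mul_sum]
    rw [Finset.sum_comm]
    refine Finset.sum_eq_zero fun i hi => ?_
    rw [← mul_zero (P.coeff i), ← hpow i (Finset.mem_range.1 hi), Finset.mul_sum]
    exact Finset.sum_congr rfl fun k _ => by ring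
  ext k
  by_cases hk : k ∈ S
  · have h := hpoly (∏ j ∈ S.erase k, (Polynomial.X - Polynomial.C (t j))) (by
      rw [Polynomial.natDegree_finsetProd_X_sub_C_eq_card, Finset.card_erase_of_mem hk]
      omega)
    rw [Finset.sum_eq_single k] at h
    · refine (mul_eq_zero.1 h).resolve_right ?_
      rw [Polynomial.eval_prod]
      refine Finset.prod_ne_zero_iff.2 ?_
      intro j hj
      simpa [sub_ne_zero] using ht.ne (Finset.ne_of_mem_erase hj).symm
    · intro j _ hj
      by_cases hjS : j ∈ S
      · rw [Polynomial.eval_prod, Finset.prod_eq_zero (Finset.mem_erase.2 ⟨hj, hjS⟩) (by simp),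
          mul_zero]
      · rw [hcS j hjS, zero_mul]
    · simp
  · exact hcS k hk

/-- `±1`. -/
def boolSign (b : Bool) : ℝ := if b then 1 else -1

lemma boolSign_ne_zero (b : Bool) : boolSign b ≠ 0 := by cases b <;> simp [boolSign]

lemma boolSign_mul_self (b : Bool) : boolSign b * boolSign b = 1 := by cases b <;> simp [boolSign]

lemma boolSign_not (b : Bool) : boolSign (!b) = -boolSign b := by cases b <;> simp [boolSign]

lemma exists_boolSign_mul_pos {x : ℝ} (hx : x ≠ 0) : ∃ b, 0 < boolSign b * x := by
  rcases lt_or_gt_of_ne hx with h | h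
  · exact ⟨false, by simpa [boolSign] using h⟩
  · exact ⟨true, by simpa [boolSign] using h⟩

/-! ### The drawing on antipodal pairs: `Sum.inl` indexes the pairs, `Sum.inr` the auxiliary points
for edges within a pair -/

section Drawing

variable {M : Type*}

/-- The coefficient vectors of the points on the edge `e`. -/
def InCone (e : Sym2 (M × Bool)) (c : M ⊕ M → ℝ) : Prop :=
  (∀ k b, 0 < boolSign b * c (Sum.inl k) → (k, b) ∈ e) ∧ (∀ k, 0 ≤ c (Sum.inr k)) ∧
    ∀ k, c (Sum.inr k) ≠ 0 → ∀ b, (k, b) ∈ e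

lemma InCone.eq_of_inr_ne_zero {e : Sym2 (M × Bool)} {c : M ⊕ M → ℝ} (h : InCone e c) {k : M}
    (hk : c (Sum.inr k) ≠ 0) : e = s((k, true), (k, false)) :=
  (Sym2.mem_and_mem_iff (by simp)).1 ⟨h.2.2 k hk true, h.2.2 k hk false⟩

lemma inCone_mk_of_ne_iff {i j : M} (hij : i ≠ j) {b b' : Bool} {c : M ⊕ M → ℝ} :
    InCone s((i, b), (j, b')) c ↔ (∀ k, k ≠ Sum.inl i → k ≠ Sum.inl j → c k = 0) ∧
      0 ≤ boolSign b * c (Sum.inl i) ∧ 0 ≤ boolSign b' * c (Sum.inl j) := by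
  constructor
  · intro h
    refine ⟨?_, ?_, ?_⟩
    · rintro (k | k) hi hj
      · by_contra hk
        obtain ⟨b₀, hb₀⟩ := exists_boolSign_mul_pos hk
        have := h.1 k b₀ hb₀
        simp only [Sym2.mem_iff, Prod.mk.injEq] at this
        rcases this with ⟨rfl, -⟩ | ⟨rfl, -⟩
        · exact hi rfl
        · exact hj rfl
      · by_contra hk
        have h1 := h.2.2 k hk b
        have h2 := h.2.2 k hk (!b)
        simp only [Sym2.mem_iff, Prod.mk.injEq] at h1 h2
        grind
    · by_contra! hlt
      have := h.1 i (!b) (by rw [boolSign_not]; linarith)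
      simp only [Sym2.mem_iff, Prod.mk.injEq] at this
      grind
    · by_contra! hlt
      have := h.1 j (!b') (by rw [boolSign_not]; linarith)
      simp only [Sym2.mem_iff, Prod.mk.injEq] at this
      grind
  · rintro ⟨h0, hi, hj⟩
    have hr : ∀ k, c (Sum.inr k) = 0 := fun k => h0 _ (by simp) (by simp)
    refine ⟨fun k b₀ hk => ?_, fun k => (hr k).ge, fun k hk => absurd (hr k) hk⟩
    rw [Sym2.mem_iff]
    by_cases hki : k = i
    · subst hki
      left
      cases b <;> cases b₀ <;> simp [boolSign] at hi hk ⊢ <;> linarith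
    by_cases hkj : k = j
    · subst hkj
      right
      cases b' <;> cases b₀ <;> simp [boolSign] at hj hk ⊢ <;> linarith
    rw [h0 (Sum.inl k) (by simpa) (by simpa), mul_zero] at hk
    exact absurd hk (lt_irrefl _)

lemma inCone_mk_not_iff {i : M} {b : Bool} {c : M ⊕ M → ℝ} :
    InCone s((i, b), (i, !b)) c ↔ (∀ k, k ≠ Sum.inl i → k ≠ Sum.inr i → c k = 0) ∧
      0 ≤ c (Sum.inr i) := by
  have hmem : ∀ k b₀, (k, b₀) ∈ s((i, b), (i, !b)) ↔ k = i := by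
    intro k b₀
    simp only [Sym2.mem_iff, Prod.mk.injEq]
    cases b <;> cases b₀ <;> simp
  simp only [InCone, hmem]
  constructor
  · rintro ⟨h1, h2, h3⟩
    refine ⟨?_, h2 i⟩
    rintro (k | k) hi hj
    · by_contra hk
      obtain ⟨b₀, hb₀⟩ := exists_boolSign_mul_pos hk
      exact hi (congrArg _ (h1 k b₀ hb₀))
    · by_contra hk
      exact hj (congrArg _ (h3 k hk true))
  · rintro ⟨h0, hi⟩
    refine ⟨fun k b₀ hk => ?_, fun k => ?_, fun k hk _ => ?_⟩
    · by_contra hki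
      rw [h0 (Sum.inl k) (by simpa) (by simp), mul_zero] at hk
      exact absurd hk (lt_irrefl _)
    · by_cases hki : k = i
      · exact hki ▸ hi
      · exact (h0 (Sum.inr k) (by simp) (by simpa)).ge
    · by_contra hki
      exact hk (h0 (Sum.inr k) (by simp) (by simpa))

lemma mk_eq_of_fst_eq {i : M} {b b' : Bool} (h : (i, b) ≠ (i, b')) : b' = !b := by
  cases b <;> cases b' <;> simp at h ⊢

lemma InCone.exists_support {e : Sym2 (M × Bool)} (he : ¬ e.IsDiag) {c : M ⊕ M → ℝ}
    (h : InCone e c) : ∃ a a', ∀ k, k ≠ a → k ≠ a' → c k = 0 := by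
  induction e with | _ v w
  obtain ⟨i, b⟩ := v
  obtain ⟨j, b'⟩ := w
  by_cases hij : i = j
  · subst hij
    obtain rfl := mk_eq_of_fst_eq (i := i) (by simpa using he)
    exact ⟨_, _, (inCone_mk_not_iff.1 h).1⟩
  · exact ⟨_, _, ((inCone_mk_of_ne_iff hij).1 h).1⟩

lemma exists_comb_eq {a a' : M ⊕ M} (ha : a ≠ a') (α β : ℝ) :
    ∃ c : M ⊕ M → ℝ, (∀ k, k ≠ a → k ≠ a' → c k = 0) ∧ c a = α ∧ c a' = β := by
  classical
  refine ⟨fun k => if k = a then α else if k = a' then β else 0, ?_, ?_, ?_⟩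
  · intro k h1 h2; simp [h1, h2]
  · simp
  · simp [ha.symm]

variable (t : M ⊕ M → ℝ)

/-- The point representing the vertex `v`. -/
noncomputable def vertexPoint (v : M × Bool) : EuclideanSpace ℝ (Fin 3) :=
  proj (boolSign v.2 • momentVec (t (Sum.inl v.1)))

variable {t}

lemma vertexPoint_injective (ht : Function.Injective t) :
    Function.Injective (vertexPoint t) := by
  rintro ⟨i, b⟩ ⟨j, b'⟩ h
  by_contra hne
  by_cases hij : i = j
  · subst hij
    obtain rfl := mk_eq_of_fst_eq hne
    refine proj_neg_ne_proj (momentVec_fst_ne_zero (t (Sum.inl i)) (boolSign_ne_zero b)) ?_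
    simpa only [vertexPoint, boolSign_not, neg_smul] using h
  · exact proj_ne_proj (linearIndependent_momentVec (ht.ne (by simpa using hij))
      (boolSign_ne_zero b) (boolSign_ne_zero b')) h

variable [Fintype M] (t)

/-- The linear combination of points of the moment curve with coefficients `c`. -/
noncomputable def comb (c : M ⊕ M → ℝ) : EuclideanSpace ℝ (Fin 3) × ℝ :=
  ∑ k, c k • momentVec (t k)

variable {t}

lemma comb_eq_of_support {c : M ⊕ M → ℝ} {a a' : M ⊕ M} (ha : a ≠ a')
    (h : ∀ k, k ≠ a → k ≠ a' → c k = 0) :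
    comb t c = c a • momentVec (t a) + c a' • momentVec (t a') := by
  classical
  exact Fintype.sum_eq_add a a' ha fun k hk => by rw [h k hk.1 hk.2, zero_smul]

/-- The difference of the two coefficient vectors is supported on at most four points of the moment
curve. -/
lemma comb_injOn (ht : Function.Injective t) {c c' : M ⊕ M → ℝ} {a b a' b' : M ⊕ M}
    (hc : ∀ k, k ≠ a → k ≠ b → c k = 0) (hc' : ∀ k, k ≠ a' → k ≠ b' → c' k = 0)
    (h : comb t c = comb t c') : c = c' := by
  classical
  rw [← sub_eq_zero]
  refine eq_zero_of_sum_momentVec_eq_zero ht ?_ {a, b, a', b'} Finset.card_le_four ?_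
  · simp only [Pi.sub_apply, sub_smul, Finset.sum_sub_distrib]
    exact sub_eq_zero.2 h
  · intro k hk
    simp only [Finset.mem_insert, Finset.mem_singleton, not_or] at hk
    simp [hc k hk.1 hk.2.1, hc' k hk.2.2.1 hk.2.2.2]

variable (t)

/-- The arc representing the edge `e`. -/
def edgeArc (e : Sym2 (M × Bool)) : Set (EuclideanSpace ℝ (Fin 3)) :=
  {x | ∃ c, InCone e c ∧ lift x = comb t c}

/-- The circle through the points of the vertices over `q`; for `q = s(k, k)`, a circle through
the two points over `k`. -/
def pairCircle (q : Sym2 M) : Set (EuclideanSpace ℝ (Fin 3)) :=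
  {x | ∃ c, ((∀ k, c (Sum.inl k) ≠ 0 → k ∈ q) ∧ ∀ k, c (Sum.inr k) ≠ 0 → q = s(k, k)) ∧
    lift x = comb t c}

variable {t}

lemma isCircularArc_edgeArc (ht : Function.Injective t) {v w : M × Bool} (hvw : v ≠ w) :
    IsCircularArc (edgeArc t s(v, w)) (vertexPoint t v) (vertexPoint t w) := by
  obtain ⟨i, b⟩ := v
  obtain ⟨j, b'⟩ := w
  by_cases hij : i = j
  · subst hij
    obtain rfl := mk_eq_of_fst_eq hvw
    have hne : (Sum.inl i : M ⊕ M) ≠ Sum.inr i := by simp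
    have := isCircularArc_halfCircle (linearIndependent_momentVec (ht.ne hne)
      (boolSign_ne_zero b) one_ne_zero)
    simp only [vertexPoint, boolSign_not, neg_smul]
    convert this using 1
    ext x
    simp only [edgeArc, Set.mem_ofPred_eq, inCone_mk_not_iff, one_smul]
    constructor
    · rintro ⟨c, ⟨h0, hc⟩, hx⟩
      refine ⟨boolSign b * c (Sum.inl i), c (Sum.inr i), ?_, hc⟩
      rw [hx, comb_eq_of_support hne h0, smul_smul, mul_right_comm, boolSign_mul_self, one_mul]
    · rintro ⟨α, β, hx, hβ⟩
      obtain ⟨c, h0, h1, h2⟩ := exists_comb_eq hne (α * boolSign b) β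
      refine ⟨c, ⟨h0, h2 ▸ hβ⟩, ?_⟩
      rw [hx, comb_eq_of_support hne h0, h1, h2, smul_smul]
  · have hne : (Sum.inl i : M ⊕ M) ≠ Sum.inl j := by simpa using hij
    have := isCircularArc_cone (linearIndependent_momentVec (ht.ne hne)
      (boolSign_ne_zero b) (boolSign_ne_zero b'))
    simp only [vertexPoint]
    convert this using 1
    ext x
    simp only [edgeArc, Set.mem_ofPred_eq, inCone_mk_of_ne_iff hij]
    constructor
    · rintro ⟨c, ⟨h0, hi, hj⟩, hx⟩
      refine ⟨_, _, ?_, hi, hj⟩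
      rw [hx, comb_eq_of_support hne h0, smul_smul, smul_smul, mul_right_comm, boolSign_mul_self,
        one_mul, mul_right_comm, boolSign_mul_self, one_mul]
    · rintro ⟨α, β, hx, hα, hβ⟩
      obtain ⟨c, h0, h1, h2⟩ := exists_comb_eq hne (α * boolSign b) (β * boolSign b')
      refine ⟨c, ⟨h0, ?_, ?_⟩, ?_⟩
      · rw [h1, mul_left_comm, boolSign_mul_self, mul_one]; exact hα
      · rw [h2, mul_left_comm, boolSign_mul_self, mul_one]; exact hβ
      · rw [hx, comb_eq_of_support hne h0, h1, h2, smul_smul, smul_smul]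

lemma isRoundSphere_pairCircle (ht : Function.Injective t) (q : Sym2 M) :
    IsRoundSphere 1 3 (pairCircle t q) := by
  have key : ∀ {a a' : M ⊕ M}, a ≠ a' →
      (∀ c : M ⊕ M → ℝ, ((∀ k, c (Sum.inl k) ≠ 0 → k ∈ q) ∧
        ∀ k, c (Sum.inr k) ≠ 0 → q = s(k, k)) ↔ ∀ k, k ≠ a → k ≠ a' → c k = 0) →
      IsRoundSphere 1 3 (pairCircle t q) := by
    intro a a' hne hq
    have := isRoundSphere_lift (linearIndependent_momentVec (ht.ne hne) one_ne_zero one_ne_zero)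
    convert this using 1
    ext x
    simp only [pairCircle, hq, Set.mem_ofPred_eq, one_smul]
    constructor
    · rintro ⟨c, h0, hx⟩
      exact ⟨_, _, hx.trans (comb_eq_of_support hne h0)⟩
    · rintro ⟨α, β, hx⟩
      obtain ⟨c, h0, h1, h2⟩ := exists_comb_eq hne α β
      exact ⟨c, h0, by rw [hx, comb_eq_of_support hne h0, h1, h2]⟩
  induction q with | _ i j
  by_cases hij : i = j
  · subst hij
    refine key (a := Sum.inl i) (a' := Sum.inr i) (by simp) fun c => ?_
    simp only [Sym2.mem_iff, or_self, Sym2.eq_iff, and_self, Sum.forall]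
    grind
  · refine key (a := Sum.inl i) (a' := Sum.inl j) (by simpa using hij) fun c => ?_
    simp only [Sym2.mem_iff, Sym2.eq_iff, Sum.forall, ne_eq, Sum.inl.injEq]
    grind

lemma edgeArc_subset_pairCircle (e : Sym2 (M × Bool)) :
    edgeArc t e ⊆ pairCircle t (e.map Prod.fst) := by
  rintro x ⟨c, hc, hx⟩
  refine ⟨c, ⟨fun k hk => ?_, fun k hk => ?_⟩, hx⟩
  · obtain ⟨b, hb⟩ := exists_boolSign_mul_pos hk
    exact Sym2.mem_map.2 ⟨_, hc.1 k b hb, rfl⟩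
  · rw [hc.eq_of_inr_ne_zero hk]
    rfl

lemma exists_lift_vertexPoint (v : M × Bool) : ∃ c : M ⊕ M → ℝ,
    (∀ k, k ≠ Sum.inl v.1 → k ≠ Sum.inr v.1 → c k = 0) ∧ 0 < boolSign v.2 * c (Sum.inl v.1) ∧
    c (Sum.inr v.1) = 0 ∧ lift (vertexPoint t v) = comb t c := by
  obtain ⟨μ, hμ, h⟩ := exists_lift_proj
    (momentVec_fst_ne_zero (t (Sum.inl v.1)) (boolSign_ne_zero v.2))
  have hne : (Sum.inl v.1 : M ⊕ M) ≠ Sum.inr v.1 := by simp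
  obtain ⟨c, h0, h1, h2⟩ := exists_comb_eq hne (μ * boolSign v.2) 0
  refine ⟨c, h0, ?_, h2, ?_⟩
  · rwa [h1, mul_left_comm, boolSign_mul_self, mul_one]
  · rw [vertexPoint, h, comb_eq_of_support hne h0, h1, h2, zero_smul, add_zero, smul_smul]

lemma vertexPoint_mem_pairCircle (v : M × Bool) : vertexPoint t v ∈ pairCircle t s(v.1, v.1) := by
  obtain ⟨c, h0, -, h2, h⟩ := exists_lift_vertexPoint (t := t) v
  refine ⟨c, ⟨fun k hk => ?_, fun k hk => ?_⟩, h⟩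
  · by_contra hkv
    exact hk (h0 _ (by simpa using hkv) (by simp))
  · by_contra hkv
    refine hk (h0 _ (by simp) fun h => hkv ?_)
    rw [Sum.inr_injective h]

lemma mem_of_vertexPoint_mem_edgeArc (ht : Function.Injective t) {e : Sym2 (M × Bool)}
    (he : ¬ e.IsDiag) {v : M × Bool} (hv : vertexPoint t v ∈ edgeArc t e) : v ∈ e := by
  obtain ⟨c, h0, h1, -, h⟩ := exists_lift_vertexPoint (t := t) v
  obtain ⟨c', hc', h'⟩ := hv
  obtain ⟨a, a', ha⟩ := hc'.exists_support he
  obtain rfl := comb_injOn ht h0 ha (h.symm.trans h')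
  exact hc'.1 _ _ h1

/-- By uniqueness one coefficient vector `c` serves both edges. A nonzero auxiliary coefficient, or
two nonzero coefficients of pairs, would determine the edge, so `c` is supported on a single vertex,
which lies on both edges. -/
lemma exists_vertexPoint_of_mem_edgeArc (ht : Function.Injective t) {e f : Sym2 (M × Bool)}
    (he : ¬ e.IsDiag) (hf : ¬ f.IsDiag) (hef : e ≠ f) {x : EuclideanSpace ℝ (Fin 3)}
    (hxe : x ∈ edgeArc t e) (hxf : x ∈ edgeArc t f) :
    ∃ v, v ∈ e ∧ v ∈ f ∧ x = vertexPoint t v := by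
  obtain ⟨c, hc, h⟩ := hxe
  obtain ⟨c', hc', h'⟩ := hxf
  obtain ⟨a, b, hab⟩ := hc.exists_support he
  obtain ⟨a', b', hab'⟩ := hc'.exists_support hf
  obtain rfl := comb_injOn ht hab hab' (h.symm.trans h')
  have hr : ∀ k, c (Sum.inr k) = 0 := by
    intro k
    by_contra hk
    exact hef ((hc.eq_of_inr_ne_zero hk).trans (hc'.eq_of_inr_ne_zero hk).symm)
  obtain ⟨k, hk⟩ : ∃ k, c (Sum.inl k) ≠ 0 := by
    by_contra! hl
    apply lift_ne_zero x
    rw [h, comb]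
    refine Finset.sum_eq_zero fun k _ => ?_
    cases k <;> simp [hl, hr]
  obtain ⟨b₀, hb₀⟩ := exists_boolSign_mul_pos hk
  refine ⟨(k, b₀), hc.1 k b₀ hb₀, hc'.1 k b₀ hb₀, ?_⟩
  have h0 : ∀ j, j ≠ Sum.inl k → j ≠ Sum.inr k → c j = 0 := by
    rintro (j | j) hj -
    · by_contra hcj
      obtain ⟨b₁, hb₁⟩ := exists_boolSign_mul_pos hcj
      have hne : (k, b₀) ≠ (j, b₁) := fun h => hj (congrArg Sum.inl (Prod.ext_iff.1 h).1.symm)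
      exact hef (((Sym2.mem_and_mem_iff hne).1 ⟨hc.1 k b₀ hb₀, hc.1 j b₁ hb₁⟩).trans
        ((Sym2.mem_and_mem_iff hne).1 ⟨hc'.1 k b₀ hb₀, hc'.1 j b₁ hb₁⟩).symm)
    · exact hr j
  refine eq_proj (momentVec_fst_ne_zero _ (boolSign_ne_zero b₀)) hb₀ ?_
  rw [h, comb_eq_of_support (by simp) h0, hr, zero_smul, add_zero, smul_smul, mul_right_comm,
    boolSign_mul_self, one_mul]

/-- The drawing of a graph whose vertices are embedded into `M × Bool`. -/
noncomputable def momentDrawing (ht : Function.Injective t) {V : Type*} (G : SimpleGraph V)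
    (φ : V ↪ M × Bool) : ArcDrawing G 3 where
  pos v := vertexPoint t (φ v)
  arc e := edgeArc t ((e : Sym2 V).map φ)
  pos_injective := (vertexPoint_injective ht).comp φ.injective
  isCircularArc v w h := isCircularArc_edgeArc ht (φ.injective.ne h.ne)
  vertex_on_arc e v hv := by
    have he : ¬ ((e : Sym2 V).map φ).IsDiag := by
      rw [Sym2.isDiag_map φ.injective]
      exact G.not_isDiag_of_mem_edgeSet e.2
    obtain ⟨w, hw, hwv⟩ := Sym2.mem_map.1 (mem_of_vertexPoint_mem_edgeArc ht he hv)
    exact φ.injective hwv ▸ hw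
  crossing_free e f hef x hx := by
    have hd : ∀ e : G.edgeSet, ¬ ((e : Sym2 V).map φ).IsDiag := fun e => by
      rw [Sym2.isDiag_map φ.injective]
      exact G.not_isDiag_of_mem_edgeSet e.2
    obtain ⟨v, hve, hvf, hxv⟩ := exists_vertexPoint_of_mem_edgeArc ht (hd e) (hd f)
      ((Sym2.map.injective φ.injective).ne (Subtype.coe_injective.ne hef)) hx.1 hx.2
    obtain ⟨w, hw, rfl⟩ := Sym2.mem_map.1 hve
    obtain ⟨w', hw', hww⟩ := Sym2.mem_map.1 hvf
    exact ⟨w, hw, φ.injective hww ▸ hw', hxv⟩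

end Drawing

/-! ### Upper bounds: counting the circles -/

lemma sphericalCoverNumber_le {V : Type*} {l d : ℕ} {G : SimpleGraph V} (D : ArcDrawing G d)
    {𝒮 : Set (Set (EuclideanSpace ℝ (Fin d)))} (h𝒮 : ∀ S ∈ 𝒮, IsRoundSphere l d S)
    (hcov : D.carrier ⊆ ⋃₀ 𝒮) : sphericalCoverNumber l d G ≤ 𝒮.encard :=
  sInf_le ⟨D, 𝒮, h𝒮, hcov, rfl⟩

lemma exists_cover_of_sphericalCoverNumber_le {V : Type*} {l d : ℕ} {G : SimpleGraph V} {m : ℕ}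
    (h : sphericalCoverNumber l d G ≤ m) :
    ∃ (D : ArcDrawing G d) (𝒮 : Set (Set (EuclideanSpace ℝ (Fin d)))),
      𝒮.Finite ∧ (∀ S ∈ 𝒮, IsRoundSphere l d S) ∧ D.carrier ⊆ ⋃₀ 𝒮 ∧
      sphericalCoverNumber l d G = (𝒮.ncard : ℕ∞) ∧ 𝒮.ncard ≤ m := by
  have hne : {k : ℕ∞ | ∃ (D : ArcDrawing G d) (𝒮 : Set (Set (EuclideanSpace ℝ (Fin d)))),
      (∀ S ∈ 𝒮, IsRoundSphere l d S) ∧ D.carrier ⊆ ⋃₀ 𝒮 ∧ 𝒮.encard = k}.Nonempty := by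
    by_contra! h0
    rw [sphericalCoverNumber, h0, sInf_empty] at h
    exact absurd h (by simp)
  obtain ⟨D, 𝒮, h𝒮, hcov, hk⟩ := csInf_mem hne
  change 𝒮.encard = sphericalCoverNumber l d G at hk
  have hfin : 𝒮.Finite := Set.finite_of_encard_le_coe (hk.trans_le h)
  have hcast : sphericalCoverNumber l d G = (𝒮.ncard : ℕ∞) := by
    rw [← hk, hfin.cast_ncard_eq]
  exact ⟨D, 𝒮, hfin, h𝒮, hcov, hcast, by rw [hcast] at h; exact_mod_cast h⟩

lemma exists_injective_real (M : Type*) [Finite M] : ∃ t : M → ℝ, Function.Injective t := by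
  obtain ⟨n, ⟨e⟩⟩ := Finite.exists_equiv_fin M
  exact ⟨fun k => (e k : ℕ), Nat.cast_injective.comp (Fin.val_injective.comp e.injective)⟩

lemma encard_range_le {α β : Type*} [Fintype α] (f : α → β) :
    (Set.range f).encard ≤ Fintype.card α := by
  rw [← Set.image_univ]
  exact (Set.encard_image_le f _).trans (by simp)

lemma sphericalCoverNumber_complete_le (n : ℕ) :
    sphericalCoverNumber 1 3 (SimpleGraph.completeGraph (Fin n)) ≤
      (((n + 1) / 2 + 1).choose 2 : ℕ) := by
  obtain ⟨t, ht⟩ := exists_injective_real (Fin ((n + 1) / 2) ⊕ Fin ((n + 1) / 2))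
  obtain ⟨φ⟩ : Nonempty (Fin n ↪ Fin ((n + 1) / 2) × Bool) :=
    Function.Embedding.nonempty_of_card_le (by simp; omega)
  refine (sphericalCoverNumber_le (momentDrawing ht _ φ) (𝒮 := Set.range (pairCircle t)) ?_
    ?_).trans ((encard_range_le _).trans ?_)
  · rintro _ ⟨q, rfl⟩
    exact isRoundSphere_pairCircle ht q
  · rintro x (⟨v, rfl⟩ | hx)
    · exact ⟨_, ⟨_, rfl⟩, vertexPoint_mem_pairCircle (φ v)⟩
    · obtain ⟨e, he⟩ := Set.mem_iUnion.1 hx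
      exact ⟨_, ⟨_, rfl⟩, edgeArc_subset_pairCircle _ he⟩
  -- The diagonal of `Sym2` accounts for the circles that join the two points of a pair.
  · rw [Sym2.card, Fintype.card_fin]

lemma sphericalCoverNumber_completeBipartite_le {p q : ℕ} (hp : 0 < p) (hq : 0 < q) :
    sphericalCoverNumber 1 3 (completeBipartiteGraph (Fin p) (Fin q)) ≤
      (((p + 1) / 2) * ((q + 1) / 2) : ℕ) := by
  set P := (p + 1) / 2 with hP
  set Q := (q + 1) / 2 with hQ
  obtain ⟨t, ht⟩ := exists_injective_real ((Fin P ⊕ Fin Q) ⊕ (Fin P ⊕ Fin Q))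
  obtain ⟨φ⟩ : Nonempty (Fin p ↪ Fin P × Bool) :=
    Function.Embedding.nonempty_of_card_le (by simp; omega)
  obtain ⟨ψ⟩ : Nonempty (Fin q ↪ Fin Q × Bool) :=
    Function.Embedding.nonempty_of_card_le (by simp; omega)
  -- Antipodal points come from the same part, so no edge lies within a pair and the diagonal
  -- circles are dropped.
  let χ : Fin p ⊕ Fin q ↪ (Fin P ⊕ Fin Q) × Bool :=
    (φ.sumMap ψ).trans (Equiv.sumProdDistrib _ _ _).symm.toEmbedding
  let D := momentDrawing ht (completeBipartiteGraph (Fin p) (Fin q)) χ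
  have hcov : ∀ i j, D.arc ⟨s(Sum.inl i, Sum.inr j), by simp⟩ ⊆
      ⋃₀ Set.range fun x : Fin P × Fin Q => pairCircle t s(Sum.inl x.1, Sum.inr x.2) :=
    fun i j x hx => ⟨_, ⟨((φ i).1, (ψ j).1), rfl⟩, edgeArc_subset_pairCircle _ hx⟩
  -- Vertices are covered as ends of edges; this is where both parts must be nonempty.
  have hend : ∀ i j, D.pos (Sum.inl i) ∈ D.arc ⟨s(Sum.inl i, Sum.inr j), by simp⟩ ∧
      D.pos (Sum.inr j) ∈ D.arc ⟨s(Sum.inl i, Sum.inr j), by simp⟩ := by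
    intro i j
    obtain ⟨c, u, v, θ, -, -, -, hθ, -, ha, hb, hA⟩ :=
      D.isCircularArc (Sum.inl i) (Sum.inr j) (by simp)
    rw [hA, ha, hb]
    exact ⟨⟨0, ⟨le_rfl, hθ.le⟩, rfl⟩, ⟨θ, ⟨hθ.le, le_rfl⟩, rfl⟩⟩
  refine (sphericalCoverNumber_le D ?_ ?_).trans ((encard_range_le
    fun x : Fin P × Fin Q => pairCircle t s(Sum.inl x.1, Sum.inr x.2)).trans (by simp))
  · rintro _ ⟨q, rfl⟩
    exact isRoundSphere_pairCircle ht _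
  · rintro x (⟨v | v, rfl⟩ | hx)
    · exact hcov v ⟨0, hq⟩ (hend v _).1
    · exact hcov ⟨0, hp⟩ v (hend _ v).2
    · obtain ⟨⟨e, he⟩, hx⟩ := Set.mem_iUnion.1 hx
      induction e with | _ v w
      rcases v with v | v <;> rcases w with w | w
      · simp at he
      · exact hcov v w hx
      · refine hcov w v ?_
        simpa only [Sym2.eq_swap] using hx
      · simp at he

lemma natCeil_half (n : ℕ) : ⌈(n : ℝ) / 2⌉₊ = (n + 1) / 2 := by
  apply le_antisymm
  · rw [Nat.ceil_le, div_le_iff₀ two_pos]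
    have : n ≤ (n + 1) / 2 * 2 := by omega
    exact_mod_cast this
  · have h := Nat.le_ceil ((n : ℝ) / 2)
    rw [div_le_iff₀ two_pos] at h
    have h' : n ≤ ⌈(n : ℝ) / 2⌉₊ * 2 := by exact_mod_cast h
    omega

end SphericalCover

theorem theorem2 :
    (∀ n : ℕ, 0 < n →
      ∃ k : ℕ, SphericalCover.sphericalCoverNumber 1 3 (SimpleGraph.completeGraph (Fin n)) = (k : ℕ∞) ∧
        ⌊(n : ℝ) ^ 2 / 8⌋₊ ≤ k ∧
        (k : ℝ) ≤ ((n : ℝ) ^ 2 + 5 * (n : ℝ) + 6) / 6) ∧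
    (∀ p q : ℕ, 0 < p → 0 < q →
      ∃ k : ℕ, SphericalCover.sphericalCoverNumber 1 3
          (completeBipartiteGraph (Fin p) (Fin q)) = (k : ℕ∞) ∧
        ⌈(p : ℝ) * (q : ℝ) / 4⌉₊ ≤ k ∧
        k ≤ ⌈(p : ℝ) / 2⌉₊ * ⌈(q : ℝ) / 2⌉₊) := by
  constructor
  · intro n hn
    obtain ⟨D, 𝒮, hfin, h𝒮, hcov, hk, hle⟩ :=
      SphericalCover.exists_cover_of_sphericalCoverNumber_le
        (SphericalCover.sphericalCoverNumber_complete_le n)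
    refine ⟨_, hk, ?_, ?_⟩
    · have h : ((n ^ 2 : ℕ) : ℝ) ≤ (8 * 𝒮.ncard + 1 : ℕ) :=
        Nat.cast_le.2 (D.sq_le_of_complete hn hfin h𝒮 hcov)
      push_cast at h
      -- The surplus `1/8` coming from odd `n` is absorbed by the floor.
      refine Nat.lt_succ_iff.1 ((Nat.floor_lt (by positivity)).2 ?_)
      push_cast
      linarith
    -- With `m = ⌈n/2⌉ ≤ (n+1)/2`, this is `4m(m+1) ≤ (n+1)(n+3)`. The resulting bound
    -- `(n+1)(n+3)/8` is smaller than the required `(n+2)(n+3)/6`.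
    · have hchoose : 8 * (((n + 1) / 2 + 1).choose 2) ≤ (n + 1) * (n + 3) := by
        rw [Nat.choose_two_right, Nat.add_sub_cancel]
        have h1 := Nat.div_mul_le_self (((n + 1) / 2 + 1) * ((n + 1) / 2)) 2
        have h2 := Nat.div_mul_le_self (n + 1) 2
        generalize (n + 1) / 2 = m at *
        nlinarith
      have h : ((8 * 𝒮.ncard : ℕ) : ℝ) ≤ ((n + 1) * (n + 3) : ℕ) := Nat.cast_le.2 (by omega)
      push_cast at h
      have hn' : (1 : ℝ) ≤ n := by exact_mod_cast hn
      nlinarith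
  · intro p q hp hq
    obtain ⟨D, 𝒮, hfin, h𝒮, hcov, hk, hle⟩ :=
      SphericalCover.exists_cover_of_sphericalCoverNumber_le
        (SphericalCover.sphericalCoverNumber_completeBipartite_le hp hq)
    refine ⟨_, hk, ?_, ?_⟩
    · have h : ((p * q : ℕ) : ℝ) ≤ (4 * 𝒮.ncard : ℕ) :=
        Nat.cast_le.2 (D.mul_le_of_completeBipartite hp hfin h𝒮 hcov)
      push_cast at h
      rw [Nat.ceil_le]
      linarith
    · rwa [SphericalCover.natCeil_half, SphericalCover.natCeil_half]
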